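/- For integers $n\ge 0$ put $T_n = n(n+1)/2$ and $(q)_n=\prod_{j=1}^{n}(1-q^j)$. For integers $N,n$ let $\genfrac{[}{]}{0pt}{}{N}{n}_q$ be the Gaussian binomial coefficient, that is, the polynomial $$\genfrac{[}{]}{0pt}{}{N}{n}_q=\frac{(q)_N}{(q)_n\,(q)_{N-n}}\in\mathbb Z[q]\quad\text{if } 0\le n\le N,\qquad \genfrac{[}{]}{0pt}{}{N}{n}_q=0\quad\text{otherwise}$$ (in particular it is $0$ whenever $N<0$). Let $K$ be a field and let $q,z\in K$ with $z\ne 0$ and $z\ne -1$, the Gaussian binomials being evaluated at $q$ as polynomials; for instance $q$ and $z$ may be independent indeterminates over $\mathbb Q$, or complex numbers. Then for every integer $L\ge 0$ $$\sum_{n=0}^{L} q^{T_n}\,\frac{z^{-n}+z^{n+1}}{1+z}=\sum_{i,j,k\ge 0} q^{T_i+T_j+T_k}\,z^{i-j}\,(-1)^k\genfrac{[}{]}{0pt}{}{L-i}{j}_q\genfrac{[}{]}{0pt}{}{L-j}{k}_q\genfrac{[}{]}{0pt}{}{L-k}{i}_q ,$$ where the sum on the right has only finitely many nonzero terms. -/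

import Mathlib

open Polynomial

/-- The triangular number `T_n = n (n + 1) / 2` (the division is exact). -/
def triangular (n : ℕ) : ℕ := n * (n + 1) / 2

/-- The `q`-shifted factorial `(a; q)_N = ∏ (0 ≤ j < N) (1 - a q ^ j)`. -/
def qShifted {R : Type*} [CommRing R] (a q : R) (N : ℕ) : R :=
  ∏ j ∈ Finset.range N, (1 - a * q ^ j)

theorem qShifted_zero {R : Type*} [CommRing R] (a q : R) : qShifted a q 0 = 1 := by
  simp [qShifted]

theorem qShifted_self_succ {R : Type*} [CommRing R] (q : R) (N : ℕ) :
    qShifted q q (N + 1) = qShifted q q N * (1 - q ^ (N + 1)) := by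
  simp [qShifted, Finset.prod_range_succ, pow_succ']

/-- `(q; q)_n (q; q)_m` divides `(q; q)_{n + m}` in `ℤ[q]`. -/
theorem qShifted_mul_dvd (n m : ℕ) :
    qShifted (X : ℤ[X]) X n * qShifted (X : ℤ[X]) X m ∣ qShifted (X : ℤ[X]) X (n + m) := by
  induction n generalizing m with
  | zero => simp [qShifted_zero]
  | succ n ihn =>
    induction m with
    | zero => simp [qShifted_zero]
    | succ m ihm =>
      obtain ⟨c, hc⟩ := ihn (m + 1)
      obtain ⟨d, hd⟩ := ihm
      have e : n + (m + 1) = n + 1 + m := by omega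
      rw [e] at hc
      refine ⟨c + X ^ (n + 1) * d, ?_⟩
      rw [show n + 1 + (m + 1) = (n + 1 + m) + 1 by omega,
        qShifted_self_succ X (n + 1 + m)]
      have h1 := qShifted_self_succ (X : ℤ[X]) n
      have h2 := qShifted_self_succ (X : ℤ[X]) m
      calc qShifted (X : ℤ[X]) X (n + 1 + m) * (1 - X ^ (n + 1 + m + 1))
          = (1 - X ^ (n + 1)) * qShifted (X : ℤ[X]) X (n + 1 + m)
            + X ^ (n + 1) * (1 - X ^ (m + 1)) * qShifted (X : ℤ[X]) X (n + 1 + m) := by ring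
        _ = (1 - X ^ (n + 1)) * (qShifted X X n * qShifted X X (m + 1) * c)
            + X ^ (n + 1) * (1 - X ^ (m + 1)) * (qShifted X X (n + 1) * qShifted X X m * d) := by
              conv_lhs =>
                congr
                · rw [hc]
                · rw [hd]
        _ = qShifted X X (n + 1) * qShifted X X (m + 1) * (c + X ^ (n + 1) * d) := by
              rw [h1, h2]; ring

/-- The Gaussian binomial `[N choose n]_q` as a polynomial in `ℤ[q]`: the exact quotient of
`(q; q)_N` by `(q; q)_n (q; q)_{N - n}` if `0 ≤ n ≤ N`, and `0` for all other integers `N, n`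
(in particular for `N < 0`). -/
noncomputable def gaussianBinomial (N n : ℤ) : ℤ[X] :=
  if 0 ≤ n ∧ 0 ≤ N - n then (qShifted_mul_dvd n.toNat (N - n).toNat).choose else 0

/-- The value `[N choose n]_q` of the Gaussian binomial at an element `q` of a ring. -/
noncomputable def qBinomial {R : Type*} [CommRing R] (q : R) (N n : ℤ) : R :=
  aeval q (gaussianBinomial N n)

theorem gaussianBinomial_spec (n m : ℕ) :
    qShifted (X : ℤ[X]) X (n + m) =
      qShifted X X n * qShifted X X m * gaussianBinomial ((n : ℤ) + m) n := by
  have h : (0 : ℤ) ≤ n ∧ (0 : ℤ) ≤ (n : ℤ) + m - n := by omega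
  have h' := (qShifted_mul_dvd (n : ℤ).toNat ((n : ℤ) + m - n).toNat).choose_spec
  rw [gaussianBinomial, if_pos h]
  simpa only [Int.toNat_natCast, add_sub_cancel_left] using h'

theorem aeval_qShifted {R : Type*} [CommRing R] (q : R) (N : ℕ) :
    aeval q (qShifted (X : ℤ[X]) X N) = qShifted q q N := by
  simp [qShifted, map_prod]

/-- Wherever the denominator does not vanish, the value is the usual quotient. -/
theorem qBinomial_eq_div {K : Type*} [Field K] (q : K) (n m : ℕ)
    (h : qShifted q q n * qShifted q q m ≠ 0) :
    qBinomial q ((n : ℤ) + m) n =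
      qShifted q q (n + m) / (qShifted q q n * qShifted q q m) := by
  rw [eq_div_iff h, qBinomial, ← aeval_qShifted q n, ← aeval_qShifted q m,
    ← aeval_qShifted q (n + m), gaussianBinomial_spec n m, map_mul, map_mul, mul_comm]

theorem qBinomial_eq_zero {R : Type*} [CommRing R] (q : R) (N n : ℤ)
    (h : ¬ (0 ≤ n ∧ 0 ≤ N - n)) : qBinomial q N n = 0 := by
  rw [qBinomial, gaussianBinomial, if_neg h, map_zero]

/-- The summand
`q ^ (T_i + T_j + T_k) z ^ (i - j) (-1) ^ k [L - i choose j]_q [L - j choose k]_q [L - k choose i]_q`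
of the triple sum, for `p = (i, j, k)`; the differences `i - j`, `L - i`, ... are integers. -/
noncomputable def tripleTerm {K : Type*} [Field K] (q z : K) (L : ℕ) (p : ℕ × ℕ × ℕ) : K :=
  q ^ (triangular p.1 + triangular p.2.1 + triangular p.2.2) *
    z ^ ((p.1 : ℤ) - (p.2.1 : ℤ)) * (-1) ^ p.2.2 *
    qBinomial q ((L : ℤ) - p.1) p.2.1 * qBinomial q ((L : ℤ) - p.2.1) p.2.2 *
    qBinomial q ((L : ℤ) - p.2.2) p.1

/-! For fixed `i`, `j` the sum over `k` has the closed form `(q)_{L-j} / (q)_i`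
(`alternatingSum_eq`), leaving a double sum `S_L` with coefficients `pairCoeff`. The two `q`-Pascal
rules give a recursion for these coefficients that the weights turn into `S_{L+2} - S_{L+1} =
-q^{L+2} (S_{L+1} - S_L) + q^{T_{L+2}} (z^{L+2} + z^{-L-2})` (`doubleSum_add_two`). The left side of
the theorem satisfies the same recursion, because `a_n = (z^{-n} + z^{n+1}) / (1 + z)` has `a_n +
a_{n+1} = z^{n+1} + z^{-n-1}`. Quotients of `q`-factorials are kept in division-free form, so `q`
may be `0` or a root of unity. -/

theorem triangular_succ (n : ℕ) : triangular (n + 1) = triangular n + (n + 1) := by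
  unfold triangular
  have h : (n + 1) * (n + 1 + 1) = n * (n + 1) + (n + 1) * 2 := by ring
  rw [h, Nat.add_mul_div_right _ _ (by norm_num)]

theorem qShifted_succ {R : Type*} [CommRing R] (a q : R) (N : ℕ) :
    qShifted a q (N + 1) = qShifted a q N * (1 - a * q ^ N) := by
  simp [qShifted, Finset.prod_range_succ]

theorem qShifted_succ_left {R : Type*} [CommRing R] (a q : R) (N : ℕ) :
    qShifted a q (N + 1) = (1 - a) * qShifted (a * q) q N := by
  simp only [qShifted, Finset.prod_range_succ', pow_zero, mul_one, pow_succ']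
  rw [mul_comm]
  simp only [mul_assoc]

/-- The Gaussian binomial coefficient with natural arguments, by its `q`-Pascal recursion. -/
def gaussChoose {R : Type*} [CommRing R] (q : R) : ℕ → ℕ → R
  | _, 0 => 1
  | 0, _ + 1 => 0
  | n + 1, k + 1 => gaussChoose q n k + q ^ (k + 1) * gaussChoose q n (k + 1)

/-! ### Gaussian binomials by recursion. -/

section GaussChoose

variable {R : Type*} [CommRing R] (q : R)

@[simp] theorem gaussChoose_zero_right (n : ℕ) : gaussChoose q n 0 = 1 := by
  cases n <;> rfl

theorem gaussChoose_succ_succ (n k : ℕ) :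
    gaussChoose q (n + 1) (k + 1) =
      gaussChoose q n k + q ^ (k + 1) * gaussChoose q n (k + 1) := rfl

theorem gaussChoose_eq_zero {n k : ℕ} (h : n < k) : gaussChoose q n k = 0 := by
  induction n generalizing k with
  | zero =>
    obtain ⟨k, rfl⟩ : ∃ m, k = m + 1 := ⟨k - 1, by omega⟩
    rfl
  | succ n ih =>
    obtain ⟨k, rfl⟩ : ∃ m, k = m + 1 := ⟨k - 1, by omega⟩
    rw [gaussChoose_succ_succ, ih (by omega), ih (by omega)]
    ring

@[simp] theorem gaussChoose_self (n : ℕ) : gaussChoose q n n = 1 := by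
  induction n with
  | zero => rfl
  | succ n ih => rw [gaussChoose_succ_succ, ih, gaussChoose_eq_zero q (Nat.lt_succ_self n)]; ring

/-- The second `q`-Pascal rule. -/
theorem gaussChoose_succ_succ' (n k : ℕ) :
    gaussChoose q (n + 1) (k + 1) =
      q ^ (n - k) * gaussChoose q n k + gaussChoose q n (k + 1) := by
  induction n generalizing k with
  | zero => cases k <;> simp [gaussChoose]
  | succ n ih =>
    cases k with
    | zero =>
      have h := ih 0
      rw [gaussChoose_succ_succ] at h ⊢
      simp only [gaussChoose_zero_right, Nat.sub_zero] at h ⊢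
      rw [gaussChoose_succ_succ]
      simp only [gaussChoose_zero_right]
      linear_combination q * h
    | succ k =>
      have h1 := ih k
      have h2 := ih (k + 1)
      have r1 := gaussChoose_succ_succ q n k
      have r2 := gaussChoose_succ_succ q n (k + 1)
      rw [gaussChoose_succ_succ q (n + 1) (k + 1), Nat.add_sub_add_right]
      rcases Nat.lt_or_ge n (k + 1) with h | h
      · rw [gaussChoose_eq_zero q h] at h1 h2 r1 r2
        linear_combination h1 + q ^ (k + 2) * h2 - q ^ (n - k) * r1 - r2
      · obtain ⟨m, rfl⟩ := Nat.exists_eq_add_of_le h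
        rw [show k + 1 + m - (k + 1) = m by omega] at h2
        rw [show k + 1 + m - k = m + 1 by omega] at h1 ⊢
        linear_combination h1 + q ^ (k + 2) * h2 - q ^ (m + 1) * r1 - r2

theorem gaussChoose_add_two (j r : ℕ) :
    gaussChoose q (j + r + 2) (j + 1) =
      q ^ (r + 1) * gaussChoose q (j + r + 1) j + gaussChoose q (j + r + 1) (j + 1) := by
  rw [gaussChoose_succ_succ', show j + r + 1 - j = r + 1 by omega]

/-- Eliminating one of the two lower terms between the two Pascal rules gives this absorption rule.
-/
theorem gaussChoose_mul_one_sub (j r : ℕ) :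
    gaussChoose q (j + r + 1) j * (1 - q ^ (r + 1)) =
      (1 - q ^ (j + r + 1)) * gaussChoose q (j + r) j := by
  cases j with
  | zero => simp
  | succ j =>
    have h1 := gaussChoose_succ_succ q (j + r + 1) j
    have h2 := gaussChoose_add_two q j r
    rw [show j + 1 + r + 1 = j + r + 2 by omega, show j + 1 + r = j + r + 1 by omega]
    rw [show j + r + 1 + 1 = j + r + 2 by omega] at h1
    linear_combination h2 - q ^ (r + 1) * h1

theorem qShifted_self_add (n m : ℕ) :
    qShifted q q (n + m) = qShifted q q n * qShifted q q m * gaussChoose q (n + m) n := by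
  induction m with
  | zero => simp [qShifted_zero]
  | succ m ih =>
    rw [← add_assoc, qShifted_self_succ, ih, qShifted_self_succ]
    linear_combination (-qShifted q q n * qShifted q q m) * gaussChoose_mul_one_sub q n m

theorem map_gaussChoose {S : Type*} [CommRing S] (f : R →+* S) (n k : ℕ) :
    f (gaussChoose q n k) = gaussChoose (f q) n k := by
  induction n generalizing k with
  | zero => cases k <;> simp [gaussChoose]
  | succ n ih =>
    cases k with
    | zero => simp
    | succ k => simp [gaussChoose_succ_succ, ih]

end GaussChoose

theorem qShifted_X_ne_zero (n : ℕ) : qShifted (X : ℤ[X]) X n ≠ 0 := by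
  refine Finset.prod_ne_zero_iff.2 fun j _ h => ?_
  simpa using congrArg (Polynomial.eval 0) h

theorem qBinomial_natCast {R : Type*} [CommRing R] (q : R) (n k : ℕ) :
    qBinomial q n k = gaussChoose q n k := by
  rcases Nat.lt_or_ge n k with h | h
  · rw [gaussChoose_eq_zero q h, qBinomial_eq_zero q _ _ (by omega)]
  · obtain ⟨m, rfl⟩ := Nat.exists_eq_add_of_le h
    have h1 : gaussianBinomial ((k : ℤ) + m) k = gaussChoose X (k + m) k := by
      -- The cancellation is done in `ℤ[X]`, where the `q`-factorials are nonzero; specialization to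
      -- `q` comes afterwards.
      apply mul_left_cancel₀ (mul_ne_zero (qShifted_X_ne_zero k) (qShifted_X_ne_zero m))
      rw [← gaussianBinomial_spec, ← qShifted_self_add]
    rw [qBinomial, Nat.cast_add, h1]
    have h2 := map_gaussChoose (X : ℤ[X]) (aeval q : ℤ[X] →ₐ[ℤ] R).toRingHom (k + m) k
    simpa using h2

theorem qBinomial_sub {R : Type*} [CommRing R] (q : R) {n m : ℕ} (h : m ≤ n) (k : ℕ) :
    qBinomial q ((n : ℤ) - m) k = gaussChoose q (n - m) k := by
  rw [← Nat.cast_sub h, qBinomial_natCast]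

/-! ### Summation over `k`. -/

section AlternatingSum

variable {R : Type*} [CommRing R] (q : R)

/-- The alternating sum `∑ (-1) ^ k q ^ T_k [N choose k] [M - k choose i]`. -/
def alternatingSum (N M i : ℕ) : R :=
  ∑ k ∈ Finset.range (N + 1),
    (-1) ^ k * q ^ triangular k * gaussChoose q N k * gaussChoose q (M - k) i

theorem alternatingSum_eq_sum_range {N n : ℕ} (h : N ≤ n) (M i : ℕ) :
    alternatingSum q N M i = ∑ k ∈ Finset.range (n + 1),
      (-1) ^ k * q ^ triangular k * gaussChoose q N k * gaussChoose q (M - k) i := by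
  refine Finset.sum_subset (Finset.range_mono (by omega)) fun k _ hk => ?_
  rw [Finset.mem_range] at hk
  rw [gaussChoose_eq_zero q (show N < k by omega)]
  ring

/-- The second Pascal rule splits `[N+1 choose k+1]`; since `T_{k+1} + (N - k) = T_k + N + 1`, the
shifted part carries the constant factor `q ^ (N + 1)`. -/
theorem alternatingSum_succ_left (N M i : ℕ) :
    alternatingSum q (N + 1) (M + 1) i =
      alternatingSum q N (M + 1) i - q ^ (N + 1) * alternatingSum q N M i := by
  rw [alternatingSum_eq_sum_range q (Nat.le_succ N) (M + 1) i, alternatingSum, alternatingSum,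
    Finset.sum_range_succ', Finset.sum_range_succ' _ (N + 1), Finset.mul_sum,
    add_sub_right_comm, ← Finset.sum_sub_distrib]
  simp only [gaussChoose_zero_right]
  congr 1
  refine Finset.sum_congr rfl fun k hk => ?_
  obtain ⟨m, rfl⟩ := Nat.exists_eq_add_of_le (Nat.lt_succ_iff.1 (Finset.mem_range.1 hk))
  rw [gaussChoose_succ_succ', Nat.add_sub_add_right, triangular_succ,
    show k + m - k = m by omega]
  ring

theorem alternatingSum_succ_right {N M : ℕ} (h : N ≤ M) (i : ℕ) :
    alternatingSum q N (M + 1) (i + 1) =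
      q ^ (i + 1) * alternatingSum q N M (i + 1) + alternatingSum q N M i := by
  simp only [alternatingSum]
  rw [Finset.mul_sum, ← Finset.sum_add_distrib]
  refine Finset.sum_congr rfl fun k hk => ?_
  rw [Finset.mem_range] at hk
  rw [show M + 1 - k = M - k + 1 by omega, gaussChoose_succ_succ]
  ring

theorem alternatingSum_self (N : ℕ) : alternatingSum q N N N = 1 := by
  rw [alternatingSum, Finset.sum_range_succ', Finset.sum_eq_zero]
  · simp [triangular]
  · intro k hk
    rw [Finset.mem_range] at hk
    rw [gaussChoose_eq_zero q (show N - (k + 1) < N by omega), mul_zero]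

/-- The alternating sum is `(q; q)_N / (q; q)_i`. -/
theorem alternatingSum_eq (i r s : ℕ) :
    alternatingSum q (i + r) (i + r + s) i = qShifted (q ^ (i + 1)) q r := by
  -- Stated separately because the base case `r = 0` also needs it: there `i` is raised through the
  -- value at `r = 1`, and `q^{i+1} + (1 - q^{i+1}) = 1`.
  have step : ∀ i r s, (∀ s, alternatingSum q (i + r) (i + r + s) i = qShifted (q ^ (i + 1)) q r) →
      alternatingSum q (i + r + 1) (i + r + 1 + s) i = qShifted (q ^ (i + 1)) q (r + 1) := by
    intro i r s ih
    rw [show i + r + 1 + s = i + r + s + 1 by omega, alternatingSum_succ_left, ih s,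
      show i + r + s + 1 = i + r + (s + 1) by omega, ih (s + 1), qShifted_succ]
    ring
  induction r generalizing s with
  | succ r ih => exact step i r s ih
  | zero =>
    rw [qShifted_zero, add_zero]
    induction i generalizing s with
    | zero =>
      simp [alternatingSum, triangular]
    | succ i ihi =>
      induction s with
      | zero => exact alternatingSum_self q (i + 1)
      | succ s ihs =>
        rw [← add_assoc, alternatingSum_succ_right q (by omega), ihs,
          step i 0 s (fun s => by rw [add_zero, qShifted_zero, ihi])]
        simp [qShifted_succ, qShifted_zero]

end AlternatingSum

/-! ### Recursions for the coefficients of the double sum. -/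

section DoubleSum

variable {R : Type*} [CommRing R] (q : R)

/-- `(q; q)_{L - i} (q; q)_{L - j} / ((q; q)_i (q; q)_j (q; q)_{L - i - j})` if `i + j ≤ L`,
and `0` otherwise. -/
def pairCoeff (L i j : ℕ) : R :=
  if i + j ≤ L then gaussChoose q (L - i) j * qShifted (q ^ (i + 1)) q (L - i - j) else 0

theorem pairCoeff_add (i j r : ℕ) :
    pairCoeff q (i + j + r) i j = gaussChoose q (j + r) j * qShifted (q ^ (i + 1)) q r := by
  rw [pairCoeff, if_pos (by omega), show i + j + r - i = j + r by omega,
    show j + r - j = r by omega]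

theorem pairCoeff_eq_zero {L i j : ℕ} (h : L < i + j) : pairCoeff q L i j = 0 :=
  if_neg (by omega)

theorem pairCoeff_succ_succ (L i j : ℕ) :
    pairCoeff q (L + 2) (i + 1) (j + 1) =
      (1 - q ^ (L + 2)) * pairCoeff q (L + 1) (i + 1) (j + 1) +
        q ^ (L - i - j) * pairCoeff q L i j := by
  rcases Nat.lt_or_ge L (i + j) with h | h
  · rw [pairCoeff_eq_zero q h, pairCoeff_eq_zero q (by omega), pairCoeff_eq_zero q (by omega)]
    ring
  obtain ⟨r, rfl⟩ := Nat.exists_eq_add_of_le h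
  rw [show i + j + r - i - j = r by omega, pairCoeff_add,
    show i + j + r + 2 = (i + 1) + (j + 1) + r by omega, pairCoeff_add]
  cases r with
  | zero =>
    rw [pairCoeff_eq_zero q (by omega)]
    simp [qShifted_zero]
  | succ r =>
    rw [show i + j + (r + 1) + 1 = (i + 1) + (j + 1) + r by omega, pairCoeff_add,
      qShifted_succ, qShifted_succ_left (q ^ (i + 1)), ← pow_succ,
      show j + 1 + (r + 1) = j + r + 2 by omega, show j + 1 + r = j + r + 1 by omega,
      show j + (r + 1) = j + r + 1 by omega]
    have h1 := gaussChoose_succ_succ q (j + r + 1) j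
    have h2 := gaussChoose_add_two q j r
    rw [show j + r + 1 + 1 = j + r + 2 by omega] at h1
    -- With the common `q`-shifted factorial removed, the factor `1 - q ^ (i + r + 2)` on the left
    -- is expanded by one Pascal rule for each of its terms.
    linear_combination qShifted (q ^ (i + 1 + 1)) q r * (h2 - q ^ (i + r + 2) * h1)

theorem pairCoeff_zero_left (L j : ℕ) :
    pairCoeff q (L + 1) 0 j =
      (1 - q ^ (L + 1)) * pairCoeff q L 0 j + if j = L + 1 then 1 else 0 := by
  rcases lt_trichotomy j (L + 1) with h | rfl | h
  · obtain ⟨r, rfl⟩ := Nat.exists_eq_add_of_le (Nat.lt_succ_iff.1 h)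
    have h1 := pairCoeff_add q 0 j r
    have h2 := pairCoeff_add q 0 j (r + 1)
    rw [Nat.zero_add] at h1 h2
    rw [if_neg (by omega), h1, add_assoc j r 1, h2, qShifted_succ, ← add_assoc]
    linear_combination qShifted (q ^ (0 + 1)) q r * gaussChoose_mul_one_sub q j r
  · rw [if_pos rfl, pairCoeff_eq_zero q (show L < 0 + (L + 1) by omega)]
    simp [pairCoeff, qShifted_zero]
  · rw [if_neg (by omega), pairCoeff_eq_zero q (by omega), pairCoeff_eq_zero q (by omega)]
    ring

theorem pairCoeff_zero_right (L i : ℕ) :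
    pairCoeff q (L + 1) i 0 =
      (1 - q ^ (L + 1)) * pairCoeff q L i 0 + if i = L + 1 then 1 else 0 := by
  rcases lt_trichotomy i (L + 1) with h | rfl | h
  · obtain ⟨r, rfl⟩ := Nat.exists_eq_add_of_le (Nat.lt_succ_iff.1 h)
    have h1 := pairCoeff_add q i 0 r
    have h2 := pairCoeff_add q i 0 (r + 1)
    rw [add_zero] at h1 h2
    rw [if_neg (by omega), h1, add_assoc i r 1, h2, qShifted_succ]
    simp only [gaussChoose_zero_right]
    ring
  · rw [if_pos rfl, pairCoeff_eq_zero q (show L < L + 1 + 0 by omega)]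
    simp [pairCoeff, qShifted_zero]
  · rw [if_neg (by omega), pairCoeff_eq_zero q (by omega), pairCoeff_eq_zero q (by omega)]
    ring

end DoubleSum

/-! ### The double sum, its recursion and its evaluation. -/

section Field

variable {K : Type*} [Field K] (q z : K)

/-- The weight `q ^ (T_i + T_j) z ^ (i - j)`. -/
def pairWeight (i j : ℕ) : K := q ^ (triangular i + triangular j) * z ^ ((i : ℤ) - (j : ℤ))

/-- The double sum left after the summation over `k`. -/
def doubleSum (L : ℕ) : K :=
  ∑ i ∈ Finset.range (L + 1), ∑ j ∈ Finset.range (L + 1), pairWeight q z i j * pairCoeff q L i j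

/-- Enlarging the index square lets sums for different `L` be compared termwise. -/
theorem doubleSum_eq_sum_range {L n : ℕ} (h : L ≤ n) :
    doubleSum q z L = ∑ i ∈ Finset.range (n + 1), ∑ j ∈ Finset.range (n + 1),
      pairWeight q z i j * pairCoeff q L i j := by
  have hz : ∀ i j, L < i + j → pairWeight q z i j * pairCoeff q L i j = 0 := fun i j hij => by
    rw [pairCoeff_eq_zero q hij, mul_zero]
  have hs : Finset.range (L + 1) ⊆ Finset.range (n + 1) := Finset.range_mono (by omega)
  rw [doubleSum, ← Finset.sum_subset hs]
  · refine Finset.sum_congr rfl fun i _ => Finset.sum_subset hs fun j _ hj => hz i j ?_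
    rw [Finset.mem_range] at hj
    omega
  · intro i _ hi
    rw [Finset.mem_range] at hi
    exact Finset.sum_eq_zero fun j _ => hz i j (by omega)

theorem pairWeight_succ_succ (i j : ℕ) :
    pairWeight q z (i + 1) (j + 1) = q ^ (i + j + 2) * pairWeight q z i j := by
  rw [pairWeight, pairWeight, triangular_succ, triangular_succ, Nat.cast_succ, Nat.cast_succ,
    add_sub_add_right_eq_sub]
  ring

theorem doubleSum_add_two (L : ℕ) :
    doubleSum q z (L + 2) = (1 - q ^ (L + 2)) * doubleSum q z (L + 1) +
      q ^ (L + 2) * doubleSum q z L +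
        q ^ triangular (L + 2) * (z ^ ((L : ℤ) + 2) + z ^ (-((L : ℤ) + 2))) := by
  -- The weight shift `q^{i+j+2}` and the coefficient `q^{L-i-j}` combine to `q^{L+2}`, independent
  -- of `i` and `j`. The two edges then supply the inhomogeneous terms `z^{±(L+2)}`, and the corner
  -- none.
  have inner : ∀ i j, pairWeight q z (i + 1) (j + 1) * pairCoeff q (L + 2) (i + 1) (j + 1) =
      (1 - q ^ (L + 2)) *
          (pairWeight q z (i + 1) (j + 1) * pairCoeff q (L + 1) (i + 1) (j + 1)) +
        q ^ (L + 2) * (pairWeight q z i j * pairCoeff q L i j) := by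
    intro i j
    rw [pairCoeff_succ_succ, pairWeight_succ_succ]
    rcases Nat.lt_or_ge L (i + j) with h | h
    · rw [pairCoeff_eq_zero q h]; ring
    · obtain ⟨r, rfl⟩ := Nat.exists_eq_add_of_le h
      rw [show i + j + r - i - j = r by omega]
      ring
  have left : ∑ j ∈ Finset.range (L + 2), pairWeight q z 0 (j + 1) * pairCoeff q (L + 2) 0 (j + 1) =
      (1 - q ^ (L + 2)) *
          ∑ j ∈ Finset.range (L + 2), pairWeight q z 0 (j + 1) * pairCoeff q (L + 1) 0 (j + 1) +
        q ^ triangular (L + 2) * z ^ (-((L : ℤ) + 2)) := by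
    simp only [pairCoeff_zero_left q (L + 1), Nat.add_right_cancel_iff, mul_add, mul_ite, mul_one,
      mul_zero, Finset.sum_add_distrib, Finset.mul_sum, Finset.sum_ite_eq', mul_left_comm]
    rw [if_pos (by simp)]
    congr 1
    simp [pairWeight, triangular]
    ring_nf
    simp
  have right : ∑ i ∈ Finset.range (L + 2), pairWeight q z (i + 1) 0 * pairCoeff q (L + 2) (i + 1) 0 =
      (1 - q ^ (L + 2)) *
          ∑ i ∈ Finset.range (L + 2), pairWeight q z (i + 1) 0 * pairCoeff q (L + 1) (i + 1) 0 +
        q ^ triangular (L + 2) * z ^ ((L : ℤ) + 2) := by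
    simp only [pairCoeff_zero_right q (L + 1), Nat.add_right_cancel_iff, mul_add, mul_ite, mul_one,
      mul_zero, Finset.sum_add_distrib, Finset.mul_sum, Finset.sum_ite_eq', mul_left_comm]
    rw [if_pos (by simp)]
    congr 1
  have corner : pairCoeff q (L + 2) 0 0 = (1 - q ^ (L + 2)) * pairCoeff q (L + 1) 0 0 := by
    rw [pairCoeff_zero_left, if_neg (by omega), add_zero]
  rw [doubleSum_eq_sum_range q z (show L + 1 ≤ L + 2 by omega),
    doubleSum_eq_sum_range q z (show L ≤ L + 1 by omega), doubleSum]
  simp only [Finset.sum_range_succ' _ (L + 2), Finset.sum_add_distrib]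
  rw [left, right, corner]
  simp only [inner, Finset.sum_add_distrib, ← Finset.mul_sum]
  ring

theorem doubleSum_eq (hz : z ≠ 0) (hz1 : 1 + z ≠ 0) (L : ℕ) :
    doubleSum q z L = ∑ n ∈ Finset.range (L + 1),
      q ^ triangular n * ((z ^ (-(n : ℤ)) + z ^ ((n : ℤ) + 1)) / (1 + z)) := by
  induction L using Nat.twoStepInduction with
  | zero => simp [doubleSum, pairWeight, pairCoeff, qShifted_zero, triangular, div_self hz1]
  | one =>
    simp [doubleSum, pairWeight, pairCoeff, qShifted, triangular, Finset.sum_range_succ,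
      div_self hz1]
    field_simp
    ring
  | more L h0 h1 =>
    rw [doubleSum_add_two, h0, h1, Finset.sum_range_succ _ (L + 2), Finset.sum_range_succ _ (L + 1)]
    have e : z ^ (-((L : ℤ) + 2)) = (z ^ (L + 2))⁻¹ := by
      rw [zpow_neg]; norm_cast
    have e' : z ^ (-((L : ℤ) + 1)) = (z ^ (L + 1))⁻¹ := by
      rw [zpow_neg]; norm_cast
    have e2 : z ^ ((L : ℤ) + 2) = z ^ (L + 2) := by norm_cast
    have e3 : z ^ ((L : ℤ) + 1 + 1) = z ^ (L + 2) := by norm_cast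
    have e4 : z ^ ((L : ℤ) + 2 + 1) = z ^ (L + 3) := by norm_cast
    push_cast
    rw [triangular_succ (L + 1), e, e', e2, e3, e4]
    field_simp
    ring

theorem support_tripleTerm_subset (L : ℕ) :
    Function.support (tripleTerm q z L) ⊆
      ((Finset.range (L + 1) ×ˢ Finset.range (L + 1) ×ˢ Finset.range (L + 1) :
        Finset (ℕ × ℕ × ℕ)) : Set (ℕ × ℕ × ℕ)) := by
  rintro ⟨i, j, k⟩ h
  by_contra hn
  apply h
  simp only [Finset.coe_product, Finset.coe_range, Set.mem_prod, Set.mem_Iio, not_and_or] at hn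
  rw [tripleTerm]
  rcases hn with hn | hn | hn
  · rw [qBinomial_eq_zero q ((L : ℤ) - k) i (by omega), mul_zero]
  · rw [qBinomial_eq_zero q ((L : ℤ) - i) j (by omega)]; simp
  · rw [qBinomial_eq_zero q ((L : ℤ) - j) k (by omega)]; simp

theorem sum_tripleTerm (L i j : ℕ) (hi : i ≤ L) (hj : j ≤ L) :
    ∑ k ∈ Finset.range (L + 1), tripleTerm q z L (i, j, k) =
      pairWeight q z i j * pairCoeff q L i j := by
  have h : ∀ k ∈ Finset.range (L + 1), tripleTerm q z L (i, j, k) =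
      pairWeight q z i j * gaussChoose q (L - i) j *
        ((-1) ^ k * q ^ triangular k * gaussChoose q (L - j) k * gaussChoose q (L - k) i) := by
    intro k hk
    have hk' : k ≤ L := Nat.lt_succ_iff.1 (Finset.mem_range.1 hk)
    simp only [tripleTerm, qBinomial_sub q hi, qBinomial_sub q hj, qBinomial_sub q hk', pairWeight]
    ring
  rw [Finset.sum_congr rfl h, ← Finset.mul_sum,
    ← alternatingSum_eq_sum_range q (Nat.sub_le L j)]
  -- The closed form of the alternating sum needs `i + j ≤ L`; otherwise `[L - i choose j]` already
  -- vanishes.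
  rcases Nat.lt_or_ge L (i + j) with hij | hij
  · rw [pairCoeff_eq_zero q hij, gaussChoose_eq_zero q (by omega)]
    ring
  · obtain ⟨r, rfl⟩ := Nat.exists_eq_add_of_le hij
    have := alternatingSum_eq q i r j
    rw [show i + r + j = i + j + r by omega] at this
    rw [pairCoeff_add, show i + j + r - j = i + r by omega, this,
      show i + j + r - i = j + r by omega]
    ring

end Field

theorem mainTheorem1 {K : Type*} [Field K] (q z : K) (hz : z ≠ 0) (hz1 : 1 + z ≠ 0) (L : ℕ) :
    (Function.support (tripleTerm q z L)).Finite ∧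
      ∑ n ∈ Finset.range (L + 1),
          q ^ triangular n * ((z ^ (-(n : ℤ)) + z ^ ((n : ℤ) + 1)) / (1 + z)) =
        ∑ᶠ p : ℕ × ℕ × ℕ, tripleTerm q z L p := by
  have hs := support_tripleTerm_subset q z L
  refine ⟨(Finset.finite_toSet _).subset hs, ?_⟩
  rw [← doubleSum_eq q z hz hz1, finsum_eq_sum_of_support_subset _ hs, Finset.sum_product,
    doubleSum]
  refine Finset.sum_congr rfl fun i hi => ?_
  rw [Finset.sum_product]
  refine Finset.sum_congr rfl fun j hj => ?_
  rw [Finset.mem_range] at hi hj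
  exact (sum_tripleTerm q z L i j (by omega) (by omega)).symm
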